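/- Let $L^2=\{(\tau,x,y)\in\mathbb{R}^3:\ -\tau^2+x^2+y^2=-1,\ \tau>0\}$ be the Lobachevskii plane with the Riemannian metric of curvature $-1$ induced by the form $\{u,v\}=-u_0v_0+u_1v_1+u_2v_2$, and let $w_0=(1,0,0)^T$. Put $a=e_{12}+e_{21}$, $c=e_{32}-e_{23}$ (real $3\times 3$ matrices). For $\beta\neq0$ let $$\gamma(t)=\exp(t(a-\beta c))\exp(t\beta c),\qquad x(t)=\gamma(t)w_0\in L^2 .$$ Let $m(t)=t,\ n(t)=t^2/2$ if $\beta^2=1$; let $m(t)=\frac{\sin(t\sqrt{\beta^2-1})}{\sqrt{\beta^2-1}},\ n(t)=\frac{1-\cos(t\sqrt{\beta^2-1})}{\beta^2-1}$ if $\beta^2>1$; and let $m(t)=\frac{\sinh(t\sqrt{1-\beta^2})}{\sqrt{1-\beta^2}},\ n(t)=\frac{\cosh(t\sqrt{1-\beta^2})-1}{1-\beta^2}$ if $\beta^2<1$. (1) The segment $x(t)$, $0\le t\le t_1$, has no self-intersection (that is, $x$ is injective on $[0,t_1]$) for every $t_1\ge 0$ if $\beta^2\le 1$, and for $0\le t_1<2\pi/\sqrt{\beta^2-1}$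 if $\beta^2>1$. (2) Let $t_1>0$ be such that the segment $x(t)$, $0\le t\le t_1$, has no self-intersection. There is a shortest arc $[x(0)x(t_1)]$ in $L^2$; denote its length by $r(t_1)$. Let $P$ be the digon (the bounded region of $L^2$) bounded by the segment $x(t)$, $0\le t\le t_1$, and the shortest arc, and let $S(t_1)$ be its area. Then $S(t_1)$ is finite; the angles of $P$ at its two vertices $x(0)$, $x(t_1)$, i.e. the angles in $[0,\pi]$ between the segment of the curve and the shortest arc there, have a common value $\psi=\psi(t_1)$; and $$S(t_1)=|\beta|t_1-2\psi,\qquad r(t_1)=\operatorname{arccosh}(1+n(t_1)),\qquad r'(t_1)=\cos\psi=\frac{m(t_1)}{\sqrt{n(t_1)(n(t_1)+2)}} .$$ Moreover $S$ is differentiable at $t_1$ with $$S'(t_1)=\frac{|\beta|\,n(t_1)}{n(t_1)+2}>0,$$ and $0<\psi<\pi/2$ if $\beta^2\le1$, or if $\beta^2>1$ and $t_1<\pi/\sqrt{\beta^2-1}$. -/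

import Mathlib

open Real Set MeasureTheory

noncomputable section

namespace Lobachevskii

/-- Minkowski space-time of dimension three; the coordinates `0, 1, 2` are `t, x, y`. -/
abbrev Mink : Type := Fin 3 → ℝ

/-- The pseudoscalar product `-t s + x x' + y y'`. -/
def mink (u v : Mink) : ℝ := -(u 0 * v 0) + u 1 * v 1 + u 2 * v 2

/-- The Lobachevskii plane: the upper sheet of the hyperboloid `{v, v} = -1`. Its Riemannian
metric is the restriction of `mink` to tangent vectors. -/
def L2 : Set Mink := {v | mink v v = -1 ∧ 0 < v 0}

/-- The point `(1, 0, 0)` of the Lobachevskii plane. -/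
def w₀ : Mink := ![1, 0, 0]

/-! ### The geodesic of the group and its projection -/

/-- The basis element `e₁₂ + e₂₁` of the Lie algebra `so(2,1)`. -/
def matA : Matrix (Fin 3) (Fin 3) ℝ := !![0, 1, 0; 1, 0, 0; 0, 0, 0]

/-- The basis element `e₃₂ - e₂₃` of the Lie algebra `so(2,1)`. -/
def matC : Matrix (Fin 3) (Fin 3) ℝ := !![0, 0, 0; 0, 0, -1; 0, 1, 0]

/-- The geodesic `γ(t) = exp(t(a - βc)) exp(tβc)` of `SO₀(2,1)`. -/
def geod (β t : ℝ) : Matrix (Fin 3) (Fin 3) ℝ :=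
  NormedSpace.exp (t • (matA - β • matC)) * NormedSpace.exp ((t * β) • matC)

/-- The projection `x(t) = γ(t) w₀` of the geodesic to the Lobachevskii plane. -/
def proj (β t : ℝ) : Mink := Matrix.mulVec (geod β t) w₀

/-- The function `m(t)` for the parameter `β`. -/
def mFun (β t : ℝ) : ℝ :=
  if β ^ 2 = 1 then t
  else if 1 < β ^ 2 then Real.sin (t * √(β ^ 2 - 1)) / √(β ^ 2 - 1)
  else Real.sinh (t * √(1 - β ^ 2)) / √(1 - β ^ 2)

/-- The function `n(t)` for the parameter `β`. -/
def nFun (β t : ℝ) : ℝ :=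
  if β ^ 2 = 1 then t ^ 2 / 2
  else if 1 < β ^ 2 then (1 - Real.cos (t * √(β ^ 2 - 1))) / (β ^ 2 - 1)
  else (Real.cosh (t * √(1 - β ^ 2)) - 1) / (1 - β ^ 2)

/-! ### Lengths, distance, shortest arcs and angles in the Lobachevskii plane -/

/-- `c`, restricted to `[a, b]`, is a `C¹` curve in the Lobachevskii plane from `p` to `q`. -/
structure IsCurve (p q : Mink) (c : ℝ → Mink) (a b : ℝ) : Prop where
  le : a ≤ b
  contDiffOn : ContDiffOn ℝ 1 c (Icc a b)
  mapsTo : MapsTo c (Icc a b) L2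
  left : c a = p
  right : c b = q

/-- The Riemannian length of the curve `c` on `[a, b]`. -/
def curveLength (c : ℝ → Mink) (a b : ℝ) : ℝ :=
  ∫ s in a..b, √(mink (derivWithin c (Icc a b) s) (derivWithin c (Icc a b) s))

/-- The Riemannian distance of the Lobachevskii plane. -/
def hypDist (p q : Mink) : ℝ :=
  sInf {l | ∃ c a b, IsCurve p q c a b ∧ l = curveLength c a b}

/-- `c : [0, l] → L²` is a shortest arc from `p` to `q`, parametrized by arclength. -/
structure IsShortestArc (p q : Mink) (c : ℝ → Mink) (l : ℝ) : Prop where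
  isCurve : IsCurve p q c 0 l
  unitSpeed : ∀ s ∈ Ioo 0 l, mink (derivWithin c (Icc 0 l) s) (derivWithin c (Icc 0 l) s) = 1
  minimal : ∀ c' a b, IsCurve p q c' a b → l ≤ curveLength c' a b

/-- The set of the points of the shortest arc `[p q]`. -/
def chord (p q : Mink) : Set Mink :=
  {z | ∃ c l, IsShortestArc p q c l ∧ z ∈ c '' Icc 0 l}

/-- The angle between two nonzero tangent vectors at a point of the Lobachevskii plane. -/
def minkAngle (u v : Mink) : ℝ :=
  Real.arccos (mink u v / (√(mink u u) * √(mink v v)))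

/-! ### Riemannian area -/

/-- The global chart of the Lobachevskii plane by the coordinates `(x, y)`. -/
def chart (z : ℝ × ℝ) : Mink := ![√(1 + z.1 ^ 2 + z.2 ^ 2), z.1, z.2]

/-- The square root of the determinant of the metric tensor in the chart. -/
def areaDensity (z : ℝ × ℝ) : ℝ :=
  √(mink (fderiv ℝ chart z (1, 0)) (fderiv ℝ chart z (1, 0)) *
      mink (fderiv ℝ chart z (0, 1)) (fderiv ℝ chart z (0, 1)) -
      mink (fderiv ℝ chart z (1, 0)) (fderiv ℝ chart z (0, 1)) ^ 2)

/-- The Riemannian area measure of the Lobachevskii plane. -/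
def areaL2 : Measure Mink :=
  Measure.map chart ((volume : Measure (ℝ × ℝ)).withDensity fun z => ENNReal.ofReal (areaDensity z))

/-! ### The digon -/

/-- The closed curve formed by the segment `x(s)`, `0 ≤ s ≤ t`, and the shortest arc `[x(0) x(t)]`. -/
def digonBoundary (β t : ℝ) : Set Mink :=
  proj β '' Icc 0 t ∪ chord (proj β 0) (proj β t)

/-- The region of the Lobachevskii plane bounded by the closed curve `digonBoundary β t`: the
points off the curve whose connected component in the complement of the curve in the plane is
bounded. (A subset of `L2` is bounded for the hyperbolic distance if and only if it is bounded
in the ambient space.) -/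
def digon (β t : ℝ) : Set Mink :=
  {p | p ∈ L2 \ digonBoundary β t ∧
    Bornology.IsBounded (connectedComponentIn (L2 \ digonBoundary β t) p)}

/-- The area `S(t)` of the digon. -/
def digonArea (β t : ℝ) : ℝ := (areaL2 (digon β t)).toReal

/-- The length `r(t)` of the shortest arc `[x(0) x(t)]`. -/
def chordLength (β t : ℝ) : ℝ := hypDist (proj β 0) (proj β t)

/-- `ψ` is the angle of the digon, at both of its vertices `x(0)` and `x(t)`: the angle there
between the segment of the curve `x` and the shortest arc `[x(0) x(t)]`, both directed away from
the vertex. The shortest arc exists, so `ψ` is determined. -/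
def IsDigonAngle (β t ψ : ℝ) : Prop :=
  (∃ c l, IsShortestArc (proj β 0) (proj β t) c l) ∧
  ∀ c l, IsShortestArc (proj β 0) (proj β t) c l →
    minkAngle (deriv (proj β) 0) (derivWithin c (Icc 0 l) 0) = ψ ∧
    minkAngle (-deriv (proj β) t) (-derivWithin c (Icc 0 l) l) = ψ

end Lobachevskii

end

/-! The factor `exp(tβc)` fixes `w₀`, so `x(t)` solves a linear equation and equals `(1 + n, m,
-βn)`. The three cases of `β²` are then absorbed in `n' = m`, `m' = 1 + (1 - β²)n`, `n(0) = m(0) =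
0`, with the first integral `m² = 2n + (1 - β²)n²`.

Shortest arcs from `w₀` are found by calibration: the function `height u` grows along any curve at
most as fast as arclength, and exactly as fast along the geodesic ray in the direction `u`. This
gives minimality, and in `IsShortestArc.eq_ray` also uniqueness, so `r = arcosh(1 + n)` and both
angles can be computed from the ray.

In the chart `(x, y)` geodesics through `w₀` are straight lines through the origin. The digon is
therefore the cone over the curve (`digon_eq`), and its area is an integral in the cone coordinates
`(ρ, s)`; integrating out `ρ` leaves `|β| n / (n + 2)`, which is `S'`.

Finally `ψ' = |β| / (n + 2)`, so `S' + 2ψ' = |β|`; since `S` and `ψ` tend to `0` at `0+`, it follows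
that `S = |β|t - 2ψ` (`digonArea_eq`), without appeal to Gauss–Bonnet. -/

noncomputable section

namespace Lobachevskii

/-! ### The curve in coordinates -/

section Exponential

attribute [local instance] Matrix.linftyOpNormedRing Matrix.linftyOpNormedAlgebra

/-- The solution of the linear equation `y' = M y` is given by the exponential. -/
theorem exp_smul_mulVec_eq {k : Type*} [Fintype k] [DecidableEq k] (M : Matrix k k ℝ)
    (y : ℝ → k → ℝ) (hy : ∀ t, HasDerivAt y (M.mulVec (y t)) t) (t : ℝ) :
    (NormedSpace.exp (t • M)).mulVec (y 0) = y t := by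
  have hE : ∀ s : ℝ, HasDerivAt (fun u : ℝ => NormedSpace.exp (u • (-M)))
      (NormedSpace.exp (s • (-M)) * (-M)) s := fun s => hasDerivAt_exp_smul_const (-M) s
  -- The product `exp(-uM) y(u)` is constant, and its value at `0` is `y 0`.
  have hd : ∀ s : ℝ, HasDerivAt (fun u : ℝ => (NormedSpace.exp (u • (-M))).mulVec (y u)) 0 s := by
    intro s
    rw [hasDerivAt_pi]
    intro i
    have h1 : ∀ j, HasDerivAt (fun u : ℝ => NormedSpace.exp (u • (-M)) i j)
        ((NormedSpace.exp (s • (-M)) * (-M)) i j) s := fun j =>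
      hasDerivAt_pi.1 (hasDerivAt_pi.1 (hE s) i) j
    have h2 : ∀ j, HasDerivAt (fun u : ℝ => y u j) (M.mulVec (y s) j) s :=
      hasDerivAt_pi.1 (hy s)
    have h3 := HasDerivAt.fun_sum (u := Finset.univ) fun j _ => (h1 j).mul (h2 j)
    have h4 : ∑ j, ((NormedSpace.exp (s • (-M)) * (-M)) i j * y s j +
        NormedSpace.exp (s • (-M)) i j * M.mulVec (y s) j) = 0 := by
      rw [Finset.sum_add_distrib]
      change ((NormedSpace.exp (s • (-M)) * (-M)).mulVec (y s)) i +
        ((NormedSpace.exp (s • (-M))).mulVec (M.mulVec (y s))) i = 0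
      rw [Matrix.mulVec_mulVec, Matrix.mul_neg, Matrix.neg_mulVec, Pi.neg_apply, neg_add_cancel]
    rw [h4] at h3
    exact h3
  have hc := is_const_of_deriv_eq_zero (fun s => (hd s).differentiableAt)
    (fun s => (hd s).deriv) t 0
  simp only [zero_smul, NormedSpace.exp_zero, Matrix.one_mulVec] at hc
  rw [← hc, Matrix.mulVec_mulVec, ← Matrix.exp_add_of_commute]
  · simp
  · exact ((Commute.refl M).neg_right.smul_right t).smul_left t

end Exponential

theorem nFun_zero (β : ℝ) : nFun β 0 = 0 := by unfold nFun; split_ifs <;> simp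

theorem mFun_zero (β : ℝ) : mFun β 0 = 0 := by unfold mFun; split_ifs <;> simp

theorem hasDerivAt_nFun (β t : ℝ) : HasDerivAt (nFun β) (mFun β t) t := by
  unfold nFun mFun
  split_ifs with h1 h2
  · refine (((hasDerivAt_id t).pow 2).div_const 2).congr_deriv ?_
    simp
  · have hk : 0 < β ^ 2 - 1 := by linarith
    have hs := Real.sqrt_pos.2 hk
    refine (((((hasDerivAt_id t).mul_const √(β ^ 2 - 1)).cos).const_sub 1).div_const
      (β ^ 2 - 1)).congr_deriv ?_
    have := Real.mul_self_sqrt hk.le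
    simp only [id, one_mul]
    rw [div_eq_div_iff hk.ne' hs.ne']
    linear_combination Real.sin (t * √(β ^ 2 - 1)) * this
  · have hk : 0 < 1 - β ^ 2 := sub_pos.2 (lt_of_le_of_ne (not_lt.1 h2) h1)
    have hs := Real.sqrt_pos.2 hk
    refine (((((hasDerivAt_id t).mul_const √(1 - β ^ 2)).cosh).sub_const 1).div_const
      (1 - β ^ 2)).congr_deriv ?_
    have := Real.mul_self_sqrt hk.le
    simp only [id, one_mul]
    rw [div_eq_div_iff hk.ne' hs.ne']
    linear_combination Real.sinh (t * √(1 - β ^ 2)) * this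

theorem hasDerivAt_mFun (β t : ℝ) : HasDerivAt (mFun β) (1 + (1 - β ^ 2) * nFun β t) t := by
  unfold nFun mFun
  split_ifs with h1 h2
  · exact (hasDerivAt_id t).congr_deriv (by simp [h1])
  · have hk : 0 < β ^ 2 - 1 := by linarith
    have hs := Real.sqrt_pos.2 hk
    refine ((((hasDerivAt_id t).mul_const √(β ^ 2 - 1)).sin).div_const √(β ^ 2 - 1)).congr_deriv ?_
    simp only [id, one_mul]
    field_simp
    ring
  · have hk : 0 < 1 - β ^ 2 := sub_pos.2 (lt_of_le_of_ne (not_lt.1 h2) h1)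
    have hs := Real.sqrt_pos.2 hk
    refine ((((hasDerivAt_id t).mul_const √(1 - β ^ 2)).sinh).div_const √(1 - β ^ 2)).congr_deriv ?_
    simp only [id, one_mul]
    field_simp
    ring

@[fun_prop]
theorem continuous_nFun (β : ℝ) : Continuous (nFun β) :=
  continuous_iff_continuousAt.2 fun t => (hasDerivAt_nFun β t).continuousAt

@[fun_prop]
theorem continuous_mFun (β : ℝ) : Continuous (mFun β) :=
  continuous_iff_continuousAt.2 fun t => (hasDerivAt_mFun β t).continuousAt

/-- A first integral of the system for `(n, m)`: the difference of the two sides has zero derivative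
and vanishes at `0`. It expresses that `x(t)` stays on the hyperboloid. -/
theorem mFun_sq (β t : ℝ) : mFun β t ^ 2 = 2 * nFun β t + (1 - β ^ 2) * nFun β t ^ 2 := by
  have hd : ∀ s, HasDerivAt
      (fun s => mFun β s ^ 2 - (2 * nFun β s + (1 - β ^ 2) * nFun β s ^ 2)) 0 s := by
    intro s
    have hm := hasDerivAt_mFun β s
    have hn := hasDerivAt_nFun β s
    refine ((hm.pow 2).sub ((hn.const_mul 2).add ((hn.pow 2).const_mul (1 - β ^ 2)))).congr_deriv ?_
    simp
    ring
  have := is_const_of_deriv_eq_zero (fun s => (hd s).differentiableAt) (fun s => (hd s).deriv) t 0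
  simp only [nFun_zero, mFun_zero] at this
  linarith

theorem nFun_nonneg (β t : ℝ) : 0 ≤ nFun β t := by
  unfold nFun
  split_ifs with h1 h2
  · positivity
  · exact div_nonneg (by linarith [Real.cos_le_one (t * √(β ^ 2 - 1))]) (by linarith)
  · have hk : 0 < 1 - β ^ 2 := sub_pos.2 (lt_of_le_of_ne (not_lt.1 h2) h1)
    exact div_nonneg (by linarith [Real.one_le_cosh (t * √(1 - β ^ 2))]) hk.le

theorem proj_eq (β t : ℝ) : proj β t = ![1 + nFun β t, mFun β t, -(β * nFun β t)] := by
  have h1 : (NormedSpace.exp ((t * β) • matC)).mulVec w₀ = w₀ := by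
    refine exp_smul_mulVec_eq matC (fun _ => w₀) (fun s => ?_) (t * β)
    refine (hasDerivAt_const s w₀).congr_deriv ?_
    ext i
    fin_cases i <;> simp [matC, w₀, Matrix.mulVec, dotProduct, Fin.sum_univ_three]
  have h2 : ∀ s, HasDerivAt (fun s => (![1 + nFun β s, mFun β s, -(β * nFun β s)] : Mink))
      ((matA - β • matC).mulVec ![1 + nFun β s, mFun β s, -(β * nFun β s)]) s := by
    intro s
    rw [hasDerivAt_pi]
    have hm := hasDerivAt_mFun β s
    have hn := hasDerivAt_nFun β s
    intro i
    fin_cases i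
    · refine (hn.const_add 1).congr_deriv ?_
      simp [matA, matC, Matrix.mulVec, dotProduct, Fin.sum_univ_three]
    · refine hm.congr_deriv ?_
      simp [matA, matC, Matrix.mulVec, dotProduct, Fin.sum_univ_three]
      ring
    · refine (hn.const_mul β).neg.congr_deriv ?_
      simp [matA, matC, Matrix.mulVec, dotProduct, Fin.sum_univ_three]
  have h3 := exp_smul_mulVec_eq _ _ h2 t
  simp only [nFun_zero, mFun_zero] at h3
  rw [proj, geod, ← Matrix.mulVec_mulVec, h1, ← h3]
  congr 1
  ext i
  fin_cases i <;> simp [w₀]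

theorem proj_zero (β : ℝ) : proj β 0 = w₀ := by
  rw [proj_eq, nFun_zero, mFun_zero]
  simp [w₀]

theorem hasDerivAt_proj (β t : ℝ) : HasDerivAt (proj β)
    ![mFun β t, 1 + (1 - β ^ 2) * nFun β t, -(β * mFun β t)] t := by
  have : proj β = fun s => ![1 + nFun β s, mFun β s, -(β * nFun β s)] := funext (proj_eq β)
  rw [this, hasDerivAt_pi]
  have hm := hasDerivAt_mFun β t
  have hn := hasDerivAt_nFun β t
  intro i
  fin_cases i
  · exact hn.const_add 1
  · exact hm
  · exact (hn.const_mul β).neg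

theorem proj_mem_L2 (β t : ℝ) : proj β t ∈ L2 := by
  have := mFun_sq β t
  have := nFun_nonneg β t
  rw [proj_eq]
  constructor
  · simp [mink]
    linarith
  · simp
    linarith

theorem proj_eq_iff (β s t : ℝ) :
    proj β s = proj β t ↔ mFun β s = mFun β t ∧ nFun β s = nFun β t := by
  rw [proj_eq, proj_eq]
  constructor
  · intro h
    have h0 := congrFun h 0
    have h1 := congrFun h 1
    simp at h0 h1
    exact ⟨h1, h0⟩
  · rintro ⟨h1, h2⟩
    rw [h1, h2]

theorem injOn_proj {β t₁ : ℝ} (h : β ^ 2 ≤ 1 ∨ t₁ < 2 * π / √(β ^ 2 - 1)) :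
    InjOn (proj β) (Icc 0 t₁) := by
  intro s hs t ht hst
  rw [proj_eq_iff] at hst
  obtain ⟨hm, hn⟩ := hst
  unfold mFun at hm
  unfold nFun at hn
  split_ifs at hm hn with h1 h2
  · exact hm
  · have hk : 0 < β ^ 2 - 1 := by linarith
    have hq := Real.sqrt_pos.2 hk
    rw [div_left_inj' hq.ne'] at hm
    rw [div_left_inj' hk.ne', sub_right_inj] at hn
    have h3 : t₁ * √(β ^ 2 - 1) < 2 * π := by
      rcases h with h | h
      · linarith
      · rwa [lt_div_iff₀ hq] at h
    -- Equal sine and cosine mean that the two arguments differ by a multiple of `2π`; both lie in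
    -- `[0, 2π)`.
    have h4 : cos (s * √(β ^ 2 - 1) - t * √(β ^ 2 - 1)) = 1 := by
      rw [Real.cos_sub, hm, hn]
      nlinarith [Real.sin_sq_add_cos_sq (t * √(β ^ 2 - 1))]
    have h5 : ∀ u ∈ Icc 0 t₁, 0 ≤ u * √(β ^ 2 - 1) ∧ u * √(β ^ 2 - 1) < 2 * π := fun u hu =>
      ⟨mul_nonneg hu.1 hq.le, (mul_le_mul_of_nonneg_right hu.2 hq.le).trans_lt h3⟩
    have h6 := (Real.cos_eq_one_iff_of_lt_of_lt (by linarith [(h5 s hs).1, (h5 t ht).2])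
      (by linarith [(h5 s hs).2, (h5 t ht).1])).1 h4
    exact mul_right_cancel₀ hq.ne' (sub_eq_zero.1 h6)
  · have hk : 0 < 1 - β ^ 2 := sub_pos.2 (lt_of_le_of_ne (not_lt.1 h2) h1)
    have hq := Real.sqrt_pos.2 hk
    rw [div_left_inj' hq.ne'] at hm
    exact mul_right_cancel₀ hq.ne' (Real.sinh_injective hm)

/-- For `β² > 1` the curve is back at `x(0)` after the period `2π / √(β² - 1)`. The strict bound
makes the absence of self-intersections an open condition on `t₁`. -/
theorem lt_of_injOn_proj {β t₁ : ℝ} (h : InjOn (proj β) (Icc 0 t₁)) :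
    β ^ 2 ≤ 1 ∨ t₁ < 2 * π / √(β ^ 2 - 1) := by
  by_contra! hc
  obtain ⟨h1, h2⟩ := hc
  have hk : 0 < β ^ 2 - 1 := by linarith
  have hq := Real.sqrt_pos.2 hk
  have hT : 0 < 2 * π / √(β ^ 2 - 1) := by positivity
  have h3 : proj β 0 = proj β (2 * π / √(β ^ 2 - 1)) := by
    rw [proj_eq_iff, mFun_zero, nFun_zero, mFun, nFun, if_neg h1.ne', if_pos h1, if_neg h1.ne',
      if_pos h1, div_mul_cancel₀ _ hq.ne', Real.sin_two_pi, Real.cos_two_pi]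
    simp
  exact hT.ne (h ⟨le_rfl, hT.le.trans h2⟩ ⟨hT.le, h2⟩ h3)

/-- The set of the times up to which the curve has no self-intersection is open. -/
theorem exists_gt_injOn_proj {β t₁ : ℝ} (h : InjOn (proj β) (Icc 0 t₁)) :
    ∃ t₂ > t₁, InjOn (proj β) (Icc 0 t₂) := by
  rcases lt_of_injOn_proj h with h | h
  · exact ⟨t₁ + 1, by linarith, injOn_proj (Or.inl h)⟩
  · obtain ⟨t₂, h1, h2⟩ := exists_between h
    exact ⟨t₂, h1, injOn_proj (Or.inr h2)⟩

/-- By the first integral `n = 0` forces `m = 0`, that is `x(t) = x(0)`. -/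
theorem nFun_pos {β t₁ t : ℝ} (h : InjOn (proj β) (Icc 0 t₁)) (ht : t ∈ Ioc 0 t₁) :
    0 < nFun β t := by
  refine (nFun_nonneg β t).lt_of_ne' fun h0 => ?_
  have hm : mFun β t = 0 := by
    have := mFun_sq β t
    rw [h0] at this
    simpa using this
  refine ht.1.ne (h ⟨le_rfl, ht.1.le.trans ht.2⟩ ⟨ht.1.le, ht.2⟩ ?_)
  rw [proj_eq_iff, mFun_zero, nFun_zero, hm, h0]
  exact ⟨rfl, rfl⟩

theorem mFun_pos {β t : ℝ} (ht : 0 < t) (h : β ^ 2 ≤ 1 ∨ t < π / √(β ^ 2 - 1)) :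
    0 < mFun β t := by
  unfold mFun
  split_ifs with h1 h2
  · exact ht
  · have hq := Real.sqrt_pos.2 (show 0 < β ^ 2 - 1 by linarith)
    refine div_pos (Real.sin_pos_of_pos_of_lt_pi (mul_pos ht hq) ?_) hq
    rcases h with h | h
    · linarith
    · rwa [lt_div_iff₀ hq] at h
  · have hk : 0 < 1 - β ^ 2 := sub_pos.2 (lt_of_le_of_ne (not_lt.1 h2) h1)
    have hq := Real.sqrt_pos.2 hk
    exact div_pos (Real.sinh_pos_iff.2 (mul_pos ht hq)) hq

/-! ### Shortest arcs issuing from `w₀` -/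

/-- The signed distance of `v` from the geodesic through `w₀` orthogonal to the unit direction
`u`. Its gradient has length one. -/
def height (u : ℝ × ℝ) (v : Mink) : ℝ := arsinh (u.1 * v 1 + u.2 * v 2)

/-- The geodesic ray from `w₀` in the unit direction `u`. -/
def ray (u : ℝ × ℝ) (s : ℝ) : Mink := ![cosh s, sinh s * u.1, sinh s * u.2]

theorem height_w₀ (u : ℝ × ℝ) : height u w₀ = 0 := by simp [height, w₀]

theorem height_ray {u : ℝ × ℝ} (hu : u.1 ^ 2 + u.2 ^ 2 = 1) (s : ℝ) : height u (ray u s) = s := by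
  have : u.1 * (sinh s * u.1) + u.2 * (sinh s * u.2) = sinh s := by linear_combination sinh s * hu
  simp [height, ray, this]

theorem ray_zero (u : ℝ × ℝ) : ray u 0 = w₀ := by
  simp [ray, w₀]

theorem ray_mem_L2 {u : ℝ × ℝ} (hu : u.1 ^ 2 + u.2 ^ 2 = 1) (s : ℝ) : ray u s ∈ L2 := by
  refine ⟨?_, by simpa [ray] using cosh_pos s⟩
  simp [mink, ray]
  linear_combination (sinh s) ^ 2 * hu - Real.cosh_sq s

theorem contDiff_ray (u : ℝ × ℝ) : ContDiff ℝ 1 (ray u) := by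
  rw [contDiff_pi]
  intro i
  fin_cases i
  · exact contDiff_cosh
  · exact contDiff_sinh.mul contDiff_const
  · exact contDiff_sinh.mul contDiff_const

theorem hasDerivAt_ray (u : ℝ × ℝ) (s : ℝ) :
    HasDerivAt (ray u) ![sinh s, cosh s * u.1, cosh s * u.2] s := by
  rw [hasDerivAt_pi]
  intro i
  fin_cases i
  · exact hasDerivAt_cosh s
  · exact (hasDerivAt_sinh s).mul_const _
  · exact (hasDerivAt_sinh s).mul_const _

theorem isCurve_ray {u : ℝ × ℝ} (hu : u.1 ^ 2 + u.2 ^ 2 = 1) {R : ℝ} (hR : 0 ≤ R) :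
    IsCurve w₀ (ray u R) (ray u) 0 R :=
  ⟨hR, (contDiff_ray u).contDiffOn, fun s _ => ray_mem_L2 hu s, ray_zero u, rfl⟩

theorem derivWithin_ray (u : ℝ × ℝ) {R s : ℝ} (hR : 0 < R) (hs : s ∈ Icc 0 R) :
    derivWithin (ray u) (Icc 0 R) s = ![sinh s, cosh s * u.1, cosh s * u.2] :=
  (hasDerivAt_ray u s).hasDerivWithinAt.derivWithin (uniqueDiffOn_Icc hR s hs)

theorem mink_derivWithin_ray {u : ℝ × ℝ} (hu : u.1 ^ 2 + u.2 ^ 2 = 1) {R s : ℝ} (hR : 0 < R)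
    (hs : s ∈ Icc 0 R) :
    mink (derivWithin (ray u) (Icc 0 R) s) (derivWithin (ray u) (Icc 0 R) s) = 1 := by
  rw [derivWithin_ray u hR hs]
  simp [mink]
  linear_combination (cosh s) ^ 2 * hu + Real.cosh_sq s

theorem curveLength_ray {u : ℝ × ℝ} (hu : u.1 ^ 2 + u.2 ^ 2 = 1) {R : ℝ} (hR : 0 < R) :
    curveLength (ray u) 0 R = R := by
  have : ∀ s ∈ uIcc 0 R, √(mink (derivWithin (ray u) (Icc 0 R) s)
      (derivWithin (ray u) (Icc 0 R) s)) = 1 := fun s hs => by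
    rw [uIcc_of_le hR.le] at hs
    rw [mink_derivWithin_ray hu hR hs, Real.sqrt_one]
  rw [curveLength, intervalIntegral.integral_congr this]
  simp

/-- The gradient of `height u` has length at most one. -/
theorem div_sqrt_le_sqrt_mink {u : ℝ × ℝ} (hu : u.1 ^ 2 + u.2 ^ 2 = 1) {v w : Mink} (hv : v ∈ L2)
    (hvw : mink v w = 0) :
    (u.1 * w 1 + u.2 * w 2) / √(1 + (u.1 * v 1 + u.2 * v 2) ^ 2) ≤ √(mink w w) := by
  obtain ⟨h1, h0⟩ := hv
  obtain ⟨p, q⟩ := u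
  simp only at hu ⊢
  -- Rotated coordinates in which `u` is the first axis.
  set a := p * v 1 + q * v 2 with ha
  set b := -q * v 1 + p * v 2 with hb
  set a' := p * w 1 + q * w 2 with ha'
  set b' := -q * w 1 + p * w 2 with hb'
  have e1 : v 0 ^ 2 = 1 + a ^ 2 + b ^ 2 := by
    simp only [mink] at h1
    rw [ha, hb]
    linear_combination -h1 - (v 1 ^ 2 + v 2 ^ 2) * hu
  have e2 : v 0 * w 0 = a * a' + b * b' := by
    simp only [mink] at hvw
    rw [ha, hb, ha', hb']
    linear_combination -hvw - (v 1 * w 1 + v 2 * w 2) * hu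
  have e3 : mink w w = -(w 0) ^ 2 + a' ^ 2 + b' ^ 2 := by
    simp only [mink]
    rw [ha', hb']
    linear_combination -(w 1 ^ 2 + w 2 ^ 2) * hu
  -- Once `w 0` is eliminated by tangency, the defect of the squared inequality times `v 0 ^ 2` is a
  -- perfect square.
  have key : v 0 ^ 2 * ((1 + a ^ 2) * mink w w - a' ^ 2) = ((1 + a ^ 2) * b' - a * b * a') ^ 2 := by
    rw [e3]
    linear_combination ((1 + a ^ 2) * (a' ^ 2 + b' ^ 2) - a' ^ 2) * e1 -
      (1 + a ^ 2) * (v 0 * w 0 + a * a' + b * b') * e2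
  have h3 : 0 ≤ (1 + a ^ 2) * mink w w - a' ^ 2 := by
    have := sq_nonneg ((1 + a ^ 2) * b' - a * b * a')
    rw [← key] at this
    exact nonneg_of_mul_nonneg_right this (by positivity)
  have hpos : 0 < 1 + a ^ 2 := by positivity
  rw [div_le_iff₀ (Real.sqrt_pos.2 hpos), mul_comm, ← Real.sqrt_mul hpos.le]
  exact Real.le_sqrt_of_sq_le (by linarith)

section Curve

variable {x y : Mink} {c : ℝ → Mink} {a b : ℝ}

theorem IsCurve.hasDerivAt (h : IsCurve x y c a b) {s : ℝ} (hs : s ∈ Ioo a b) :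
    HasDerivAt c (derivWithin c (Icc a b) s) s :=
  ((h.contDiffOn.differentiableOn one_ne_zero) s (Ioo_subset_Icc_self hs)).hasDerivWithinAt.hasDerivAt
    (Icc_mem_nhds hs.1 hs.2)

theorem IsCurve.mink_derivWithin (h : IsCurve x y c a b) {s : ℝ} (hs : s ∈ Ioo a b) :
    mink (c s) (derivWithin c (Icc a b) s) = 0 := by
  have hd := hasDerivAt_pi.1 (h.hasDerivAt hs)
  have h1 : HasDerivAt (fun r => mink (c r) (c r))
      (2 * mink (c s) (derivWithin c (Icc a b) s)) s := by
    refine ((((hd 0).mul (hd 0)).neg.add ((hd 1).mul (hd 1))).add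
      ((hd 2).mul (hd 2))).congr_deriv ?_
    simp only [mink]
    ring
  have h2 : HasDerivAt (fun r => mink (c r) (c r)) 0 s := by
    refine (hasDerivAt_const s (-1 : ℝ)).congr_of_eventuallyEq ?_
    filter_upwards [Ioo_mem_nhds hs.1 hs.2] with r hr
    exact (h.mapsTo (Ioo_subset_Icc_self hr)).1
  have := h1.unique h2
  linarith

theorem IsCurve.hasDerivAt_height (h : IsCurve x y c a b) (u : ℝ × ℝ) {s : ℝ} (hs : s ∈ Ioo a b) :
    HasDerivAt (fun r => height u (c r))
      ((u.1 * derivWithin c (Icc a b) s 1 + u.2 * derivWithin c (Icc a b) s 2) /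
        √(1 + (u.1 * c s 1 + u.2 * c s 2) ^ 2)) s := by
  have hd := hasDerivAt_pi.1 (h.hasDerivAt hs)
  refine (((hd 1).const_mul u.1).add ((hd 2).const_mul u.2)).arsinh.congr_deriv ?_
  rw [smul_eq_mul, inv_mul_eq_div]
  rfl

theorem IsCurve.continuousOn_height (h : IsCurve x y c a b) (u : ℝ × ℝ) :
    ContinuousOn (fun r => height u (c r)) (Icc a b) := by
  have hc := continuousOn_pi.1 h.contDiffOn.continuousOn
  exact ((continuousOn_const.mul (hc 1)).add (continuousOn_const.mul (hc 2))).arsinh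

/-- The calibration inequality: the gradient bound integrated along the curve. -/
theorem IsCurve.height_sub_le (h : IsCurve x y c a b) {u : ℝ × ℝ} (hu : u.1 ^ 2 + u.2 ^ 2 = 1) :
    height u y - height u x ≤ curveLength c a b := by
  rcases h.le.eq_or_lt with hab | hab
  · have : x = y := by rw [← h.left, ← h.right, hab]
    simp [this, curveLength, hab]
  · rw [← h.left, ← h.right]
    refine intervalIntegral.sub_le_integral_of_hasDeriv_right_of_le h.le
      (h.continuousOn_height u) (fun s hs => (h.hasDerivAt_height u hs).hasDerivWithinAt) ?_
      fun s hs => div_sqrt_le_sqrt_mink hu (h.mapsTo (Ioo_subset_Icc_self hs))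
        (h.mink_derivWithin hs)
    have hc := continuousOn_pi.1
      (h.contDiffOn.continuousOn_derivWithin (uniqueDiffOn_Icc hab) le_rfl)
    refine ContinuousOn.integrableOn_Icc (ContinuousOn.sqrt ?_)
    exact (((hc 0).mul (hc 0)).neg.add ((hc 1).mul (hc 1))).add ((hc 2).mul (hc 2))

end Curve

theorem isShortestArc_ray {u : ℝ × ℝ} (hu : u.1 ^ 2 + u.2 ^ 2 = 1) {R : ℝ} (hR : 0 < R) :
    IsShortestArc w₀ (ray u R) (ray u) R where
  isCurve := isCurve_ray hu hR.le
  unitSpeed s hs := mink_derivWithin_ray hu hR (Ioo_subset_Icc_self hs)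
  minimal c' a b h := by
    have := h.height_sub_le hu
    rwa [height_w₀, height_ray hu, sub_zero] at this

theorem hypDist_ray {u : ℝ × ℝ} (hu : u.1 ^ 2 + u.2 ^ 2 = 1) {R : ℝ} (hR : 0 < R) :
    hypDist w₀ (ray u R) = R := by
  refine IsLeast.csInf_eq ⟨⟨ray u, 0, R, isCurve_ray hu hR.le, (curveLength_ray hu hR).symm⟩, ?_⟩
  rintro l ⟨c, a, b, h, rfl⟩
  exact (isShortestArc_ray hu hR).minimal c a b h

/-- A unit speed curve does not increase `height u` faster than arclength. -/
theorem IsShortestArc.monotoneOn_sub_height {x y : Mink} {c : ℝ → Mink} {l : ℝ}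
    (h : IsShortestArc x y c l) {u : ℝ × ℝ} (hu : u.1 ^ 2 + u.2 ^ 2 = 1) :
    MonotoneOn (fun s => s - height u (c s)) (Icc 0 l) := by
  refine monotoneOn_of_deriv_nonneg (convex_Icc 0 l)
    (continuousOn_id.sub (h.isCurve.continuousOn_height u)) (fun s hs => ?_) (fun s hs => ?_)
  · rw [interior_Icc] at hs
    exact ((hasDerivAt_id s).sub
      (h.isCurve.hasDerivAt_height u hs)).differentiableAt.differentiableWithinAt
  · rw [interior_Icc] at hs
    have h1 := (hasDerivAt_id s).fun_sub (h.isCurve.hasDerivAt_height u hs)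
    have h2 := div_sqrt_le_sqrt_mink hu (h.isCurve.mapsTo (Ioo_subset_Icc_self hs))
      (h.isCurve.mink_derivWithin hs)
    rw [h.unitSpeed s hs, Real.sqrt_one] at h2
    simp only [id] at h1
    rw [h1.deriv]
    linarith

/-- `sinh (height u v)` is the Euclidean inner product of `u` with `(v 1, v 2)`. If `u` maximizes it
among unit directions, then `(v 1, v 2)` is `sinh s` times `u`, and the hyperboloid determines `v
0`. -/
theorem eq_ray_of_height {u : ℝ × ℝ} (hu : u.1 ^ 2 + u.2 ^ 2 = 1) {v : Mink} (hv : v ∈ L2) {s : ℝ}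
    (hs : height u v = s) (h : ∀ u' : ℝ × ℝ, u'.1 ^ 2 + u'.2 ^ 2 = 1 → height u' v ≤ s) :
    v = ray u s := by
  obtain ⟨p, q⟩ := u
  simp only at hu
  have h1 : p * v 1 + q * v 2 = sinh s := by rw [← hs, height, sinh_arsinh]
  have h2 : v 1 ^ 2 + v 2 ^ 2 ≤ sinh s ^ 2 := by
    rcases (add_nonneg (sq_nonneg (v 1)) (sq_nonneg (v 2))).eq_or_lt with h0 | h0
    · rw [← h0]
      positivity
    · have hr := Real.sqrt_pos.2 h0
      have hr2 := Real.sq_sqrt h0.le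
      set r := √(v 1 ^ 2 + v 2 ^ 2)
      have h3 := h (v 1 / r, v 2 / r) (by
        simp only
        field_simp
        linarith)
      have h4 : v 1 / r * v 1 + v 2 / r * v 2 = r := by
        field_simp
        linarith
      simp only [height] at h3
      rw [h4, ← sinh_le_sinh, sinh_arsinh] at h3
      nlinarith
  have h3 : (-q * v 1 + p * v 2) ^ 2 = 0 := by
    refine le_antisymm ?_ (sq_nonneg _)
    have : (-q * v 1 + p * v 2) ^ 2 = v 1 ^ 2 + v 2 ^ 2 - sinh s ^ 2 := by
      rw [← h1]
      linear_combination (v 1 ^ 2 + v 2 ^ 2) * hu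
    linarith
  have h4 : -q * v 1 + p * v 2 = 0 := by simpa using h3
  have e1 : v 1 = sinh s * p := by
    rw [← h1]
    linear_combination -v 1 * hu - q * h4
  have e2 : v 2 = sinh s * q := by
    rw [← h1]
    linear_combination -v 2 * hu + p * h4
  have e0 : v 0 = cosh s := by
    have h5 : v 0 ^ 2 = cosh s ^ 2 := by
      have := hv.1
      simp only [mink] at this
      rw [e1, e2] at this
      linear_combination -this + sinh s ^ 2 * hu - Real.cosh_sq s
    exact (sq_eq_sq₀ hv.2.le (cosh_pos s).le).1 h5
  ext i
  fin_cases i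
  · exact e0
  · exact e1
  · exact e2

/-- The shortest arc from `w₀` is unique. -/
theorem IsShortestArc.eq_ray {u : ℝ × ℝ} (hu : u.1 ^ 2 + u.2 ^ 2 = 1) {R : ℝ} (hR : 0 < R)
    {c : ℝ → Mink} {l : ℝ} (h : IsShortestArc w₀ (ray u R) c l) :
    l = R ∧ EqOn c (ray u) (Icc 0 R) := by
  have hl := h.isCurve.le
  have h1 := h.monotoneOn_sub_height hu
  have e0 : height u (c 0) = 0 := by rw [h.isCurve.left, height_w₀]
  have el : height u (c l) = R := by rw [h.isCurve.right, height_ray hu]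
  have hlR : l = R := by
    refine le_antisymm ?_ ?_
    · have := h.minimal _ _ _ (isCurve_ray hu hR.le)
      rwa [curveLength_ray hu hR] at this
    · have := h1 ⟨le_rfl, hl⟩ ⟨hl, le_rfl⟩ hl
      simp only [e0, el] at this
      linarith
  refine ⟨hlR, fun s hs => ?_⟩
  rw [← hlR] at hs
  -- The monotone function `s - height u (c s)` vanishes at both ends, so it vanishes throughout;
  -- for any other direction monotonicity still gives `height u' (c s) ≤ s`.
  refine eq_ray_of_height hu (h.isCurve.mapsTo hs) (le_antisymm ?_ ?_) fun u' hu' => ?_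
  · have := h1 ⟨le_rfl, hl⟩ hs hs.1
    simp only [e0] at this
    linarith
  · have := h1 hs ⟨hl, le_rfl⟩ hs.2
    simp only [el] at this
    linarith
  · have := h.monotoneOn_sub_height hu' ⟨le_rfl, hl⟩ hs hs.1
    simp only [h.isCurve.left, height_w₀] at this
    linarith

theorem chord_ray {u : ℝ × ℝ} (hu : u.1 ^ 2 + u.2 ^ 2 = 1) {R : ℝ} (hR : 0 < R) :
    chord w₀ (ray u R) = ray u '' Icc 0 R := by
  ext z
  constructor
  · rintro ⟨c, l, h, hz⟩
    obtain ⟨rfl, h2⟩ := h.eq_ray hu hR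
    rwa [h2.image_eq] at hz
  · exact fun hz => ⟨ray u, R, isShortestArc_ray hu hR, hz⟩

/-! ### The digon in the chart -/

theorem continuous_chart : Continuous chart := by
  refine continuous_pi fun i => ?_
  fin_cases i
  · exact ((continuous_const.add (continuous_fst.pow 2)).add (continuous_snd.pow 2)).sqrt
  · exact continuous_fst
  · exact continuous_snd

theorem chart_mem_L2 (z : ℝ × ℝ) : chart z ∈ L2 := by
  have h : 0 < 1 + z.1 ^ 2 + z.2 ^ 2 := by positivity
  refine ⟨?_, by simpa [chart] using Real.sqrt_pos.2 h⟩
  simp [mink, chart, Real.mul_self_sqrt h.le]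
  ring

theorem chart_of_mem_L2 {v : Mink} (hv : v ∈ L2) : chart (v 1, v 2) = v := by
  ext i
  fin_cases i
  · have : 1 + v 1 ^ 2 + v 2 ^ 2 = v 0 ^ 2 := by
      have := hv.1
      simp only [mink] at this
      linear_combination this
    simp [chart, this, Real.sqrt_sq hv.2.le]
  · rfl
  · rfl

theorem chart_injective : Function.Injective chart := by
  intro z z' h
  exact Prod.ext (congrFun h 1) (congrFun h 2)

theorem measurableSet_L2 : MeasurableSet L2 := by
  refine MeasurableSet.inter (measurableSet_eq_fun ?_ measurable_const)
    (measurableSet_lt measurable_const (measurable_pi_apply 0))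
  unfold mink
  fun_prop

theorem chart_image_eq (A : Set (ℝ × ℝ)) : chart '' A = L2 ∩ {v | (v 1, v 2) ∈ A} := by
  ext v
  constructor
  · rintro ⟨z, hz, rfl⟩
    exact ⟨chart_mem_L2 z, hz⟩
  · rintro ⟨hv, hA⟩
    exact ⟨_, hA, chart_of_mem_L2 hv⟩

/-- The interior of a closed curve `C` in the chart, given as an open set `Ω` such that `Ω ∪ C`
is compact and star-shaped. -/
theorem interior_eq_chart_image {Ω C : Set (ℝ × ℝ)} (hΩ : IsOpen Ω) (hK : IsCompact (Ω ∪ C))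
    (hd : Disjoint Ω C) (h0 : 0 ∈ Ω ∪ C)
    (hstar : ∀ z ∈ Ω ∪ C, ∀ r ∈ Icc (0 : ℝ) 1, r • z ∈ Ω ∪ C) :
    {p | p ∈ L2 \ chart '' C ∧
      Bornology.IsBounded (connectedComponentIn (L2 \ chart '' C) p)} = chart '' Ω := by
  have hpr : Continuous fun v : Mink => (v 1, v 2) := by fun_prop
  ext p
  constructor
  · rintro ⟨⟨hp, hpC⟩, hb⟩
    obtain ⟨z, rfl⟩ : ∃ z, chart z = p := ⟨_, chart_of_mem_L2 hp⟩
    refine ⟨z, ?_, rfl⟩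
    by_contra hz
    have hzK : z ∉ Ω ∪ C := fun h => h.elim hz fun h => hpC ⟨z, h, rfl⟩
    -- By star-shapedness the outward ray from an exterior point never meets `Ω ∪ C`, so the
    -- component of that point is unbounded.
    have hout : ∀ r ∈ Ici (1 : ℝ), r • z ∉ Ω ∪ C := by
      intro r hr h
      have hr0 : (0 : ℝ) < r := lt_of_lt_of_le one_pos hr
      have := hstar _ h r⁻¹ ⟨inv_nonneg.2 hr0.le, inv_le_one_of_one_le₀ hr⟩
      rw [inv_smul_smul₀ hr0.ne'] at this
      exact hzK this
    have hz0 : z ≠ 0 := fun h => hzK (h ▸ h0)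
    have hconn : IsPreconnected ((fun r : ℝ => chart (r • z)) '' Ici 1) :=
      isPreconnected_Ici.image _ (continuous_chart.comp (by fun_prop)).continuousOn
    have hsub := hconn.subset_connectedComponentIn (F := L2 \ chart '' C)
      (x := chart z)
      ⟨1, self_mem_Ici, by simp⟩ (by
        rintro _ ⟨r, hr, rfl⟩
        refine ⟨chart_mem_L2 _, ?_⟩
        rw [chart_injective.mem_set_image]
        exact fun h => hout r hr (Or.inr h))
    obtain ⟨M, hM⟩ := (hb.subset hsub).exists_norm_le
    have hM' : ∀ r ∈ Ici (1 : ℝ), r * ‖z‖ ≤ M := by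
      intro r hr
      refine le_trans ?_ (hM _ ⟨r, hr, rfl⟩)
      have hr0 : (0 : ℝ) ≤ r := zero_le_one.trans hr
      rw [← Real.norm_of_nonneg hr0, ← norm_smul, Prod.norm_def]
      rw [Real.norm_of_nonneg hr0]
      exact max_le (norm_le_pi_norm (chart (r • z)) 1) (norm_le_pi_norm (chart (r • z)) 2)
    have hzp := norm_pos_iff.2 hz0
    have := hM' (max 1 ((M + 1) / ‖z‖)) (mem_Ici.2 (le_max_left _ _))
    have h2 : M + 1 ≤ max 1 ((M + 1) / ‖z‖) * ‖z‖ := by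
      rw [← div_le_iff₀ hzp]
      exact le_max_right _ _
    linarith
  · rintro ⟨z, hz, rfl⟩
    have hmem : chart z ∈ L2 \ chart '' C := by
      refine ⟨chart_mem_L2 z, ?_⟩
      rw [chart_injective.mem_set_image]
      exact disjoint_left.1 hd hz
    refine ⟨hmem, ?_⟩
    set Y := connectedComponentIn (L2 \ chart '' C) (chart z) with hY
    have hYs : Y ⊆ L2 \ chart '' C := connectedComponentIn_subset _ _
    have hYz : chart z ∈ Y := mem_connectedComponentIn hmem
    -- Off `C` the plane splits into the disjoint open sets `Ω` and the complement of `Ω ∪ C`; a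
    -- connected set meeting `Ω` stays in `Ω`.
    have hY' : (fun v : Mink => (v 1, v 2)) '' Y ⊆ Ω := by
      refine IsPreconnected.subset_left_of_subset_union hΩ hK.isClosed.isOpen_compl ?_ ?_ ?_
        (isPreconnected_connectedComponentIn.image _ hpr.continuousOn)
      · exact disjoint_left.2 fun x hx hx' => hx' (Or.inl hx)
      · rintro _ ⟨v, hv, rfl⟩
        by_cases h : (v 1, v 2) ∈ Ω ∪ C
        · refine h.elim Or.inl fun h => absurd ?_ (hYs hv).2
          exact ⟨_, h, chart_of_mem_L2 (hYs hv).1⟩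
        · exact Or.inr h
      · exact ⟨z, ⟨_, hYz, rfl⟩, hz⟩
    refine (hK.image continuous_chart).isBounded.subset fun v hv => ?_
    exact ⟨_, Or.inl (hY' ⟨v, hv, rfl⟩), chart_of_mem_L2 (hYs hv).1⟩

/-- The curve `x(s)` in the chart. -/
def planeCurve (β s : ℝ) : ℝ × ℝ := (mFun β s, -(β * nFun β s))

theorem proj_eq_chart (β s : ℝ) : proj β s = chart (planeCurve β s) := by
  rw [← chart_of_mem_L2 (proj_mem_L2 β s), proj_eq]
  rfl

/-- The cone over the curve with the vertex at the origin of the chart. -/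
def cone (β : ℝ) (p : ℝ × ℝ) : ℝ × ℝ := (p.1 * mFun β p.2, p.1 * -(β * nFun β p.2))

theorem continuous_cone (β : ℝ) : Continuous (cone β) := by
  unfold cone
  fun_prop

/-- In the chart the curve lies on a conic through the origin, which a ray from the origin meets at
most once more. In formulas, `ρm` and `ρn` determine `2ρ²n = (ρm)² - (1 - β²)(ρn)²`, hence `ρ`,
since `n > 0`. -/
theorem cone_injOn {β t : ℝ} (hβ : β ≠ 0) (h : InjOn (proj β) (Icc 0 t)) {p q : ℝ × ℝ}
    (hp : 0 < p.1) (hps : p.2 ∈ Ioc 0 t) (hq : 0 < q.1) (hqs : q.2 ∈ Ioc 0 t)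
    (hpq : cone β p = cone β q) : p = q := by
  obtain ⟨ρ, s⟩ := p
  obtain ⟨σ, r⟩ := q
  simp only at hp hps hq hqs
  have hn := nFun_pos h hps
  have hn' := nFun_pos h hqs
  have hm := mFun_sq β s
  have hm' := mFun_sq β r
  have e1 : ρ * mFun β s = σ * mFun β r := congrArg Prod.fst hpq
  have e2 : ρ * -(β * nFun β s) = σ * -(β * nFun β r) := congrArg Prod.snd hpq
  replace e2 : ρ * nFun β s = σ * nFun β r := by
    apply mul_left_cancel₀ hβ
    linear_combination -e2
  have e3 : ρ * (ρ * nFun β s) = σ * (σ * nFun β r) := by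
    have h1 : (ρ * mFun β s) ^ 2 = (σ * mFun β r) ^ 2 := by rw [e1]
    have h2 : (ρ * nFun β s) ^ 2 = (σ * nFun β r) ^ 2 := by rw [e2]
    linear_combination h1 / 2 - (1 - β ^ 2) / 2 * h2 - ρ ^ 2 / 2 * hm + σ ^ 2 / 2 * hm'
  have hρ : ρ = σ := by
    rw [e2] at e3
    exact mul_right_cancel₀ (mul_pos hq hn').ne' e3
  subst hρ
  have hs : s = r := h ⟨hps.1.le, hps.2⟩ ⟨hqs.1.le, hqs.2⟩ <|
    (proj_eq_iff β s r).2 ⟨mul_left_cancel₀ hp.ne' e1, mul_left_cancel₀ hp.ne' e2⟩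
  rw [hs]

/-- The derivative of `cone`. -/
def coneDeriv (β : ℝ) (p : ℝ × ℝ) : ℝ × ℝ →L[ℝ] ℝ × ℝ :=
  (Matrix.toLin (.finTwoProd ℝ) (.finTwoProd ℝ)
    !![mFun β p.2, p.1 * (1 + (1 - β ^ 2) * nFun β p.2);
      -(β * nFun β p.2), p.1 * -(β * mFun β p.2)]).toContinuousLinearMap

theorem hasFDerivAt_cone (β : ℝ) (p : ℝ × ℝ) : HasFDerivAt (cone β) (coneDeriv β p) p := by
  unfold coneDeriv
  rw [Matrix.toLin_finTwoProd_toContinuousLinearMap]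
  have hm := hasDerivAt_mFun β p.2
  have hn := ((hasDerivAt_nFun β p.2).const_mul β).neg
  convert!
    HasFDerivAt.prodMk (𝕜 := ℝ)
      (hasFDerivAt_fst.mul (hm.comp_hasFDerivAt p hasFDerivAt_snd))
      (hasFDerivAt_fst.mul (hn.comp_hasFDerivAt p hasFDerivAt_snd)) using
    2 <;>
  simp [smul_smul, add_comm, neg_smul _ (ContinuousLinearMap.snd ℝ ℝ ℝ),
    neg_smul _ (ContinuousLinearMap.fst ℝ ℝ ℝ)]

theorem det_coneDeriv (β : ℝ) (p : ℝ × ℝ) : (coneDeriv β p).det = -(β * (p.1 * nFun β p.2)) := by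
  unfold coneDeriv
  simp only [LinearMap.det_toContinuousLinearMap, LinearMap.det_toLin, Matrix.det_fin_two_of]
  linear_combination -(β * p.1) * mFun_sq β p.2

theorem continuous_coneDeriv (β : ℝ) : Continuous (coneDeriv β) := by
  unfold coneDeriv
  simp_rw [Matrix.toLin_finTwoProd_toContinuousLinearMap]
  exact (ContinuousLinearMap.prodₗᵢ ℝ).continuous.comp
    (Continuous.prodMk (by fun_prop) (by fun_prop))

/-- The Jacobian `-βρn` does not vanish inside the rectangle, so the cone map is locally open there.
-/
theorem isOpen_cone_image {β t : ℝ} (hβ : β ≠ 0) (h : InjOn (proj β) (Icc 0 t)) :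
    IsOpen (cone β '' Ioo 0 1 ×ˢ Ioo 0 t) := by
  rw [isOpen_iff_mem_nhds]
  rintro _ ⟨p, hp, rfl⟩
  have hs : HasStrictFDerivAt (cone β) (coneDeriv β p) p :=
    hasStrictFDerivAt_of_hasFDerivAt_of_continuousAt
      (Filter.Eventually.of_forall fun q => hasFDerivAt_cone β q) (continuous_coneDeriv β).continuousAt
  have hn := nFun_pos h ⟨hp.2.1, hp.2.2.le⟩
  have hdet : LinearMap.det (coneDeriv β p : ℝ × ℝ →ₗ[ℝ] ℝ × ℝ) ≠ 0 := by
    have := det_coneDeriv β p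
    rw [ContinuousLinearMap.det] at this
    rw [this]
    exact neg_ne_zero.2 (mul_ne_zero hβ (mul_pos hp.1.1 hn).ne')
  have hr : LinearMap.range (coneDeriv β p : ℝ × ℝ →ₗ[ℝ] ℝ × ℝ) = ⊤ :=
    LinearMap.range_eq_top.2 ((LinearMap.equivOfDetNeZero _ hdet).surjective)
  rw [← hs.map_nhds_eq_of_surj hr]
  exact Filter.image_mem_map ((isOpen_Ioo.prod isOpen_Ioo).mem_nhds hp)

/-- The direction of the shortest arc `[x(0) x(t)]` at `x(0)`. -/
def chordDir (β t : ℝ) : ℝ × ℝ :=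
  (mFun β t / √(nFun β t * (nFun β t + 2)), -(β * nFun β t) / √(nFun β t * (nFun β t + 2)))

theorem chordDir_sq {β t : ℝ} (hn : 0 < nFun β t) : (chordDir β t).1 ^ 2 + (chordDir β t).2 ^ 2 = 1 := by
  have h : 0 < nFun β t * (nFun β t + 2) := by positivity
  simp only [chordDir]
  rw [div_pow, div_pow, Real.sq_sqrt h.le, ← add_div, div_eq_one_iff_eq h.ne']
  linear_combination mFun_sq β t

theorem sinh_arcosh_nFun {β t : ℝ} (hn : 0 < nFun β t) :
    sinh (arcosh (1 + nFun β t)) = √(nFun β t * (nFun β t + 2)) := by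
  rw [sinh_arcosh (by linarith)]
  congr 1
  ring

theorem arcosh_nFun_pos {β t : ℝ} (hn : 0 < nFun β t) : 0 < arcosh (1 + nFun β t) := arcosh_pos (by linarith)

theorem proj_eq_ray {β t : ℝ} (hn : 0 < nFun β t) : proj β t = ray (chordDir β t) (arcosh (1 + nFun β t)) := by
  have h : 0 < √(nFun β t * (nFun β t + 2)) := Real.sqrt_pos.2 (by positivity)
  rw [proj_eq, ray, sinh_arcosh_nFun hn, cosh_arcosh (by linarith)]
  simp only [chordDir]
  rw [mul_div_cancel₀ _ h.ne', mul_div_cancel₀ _ h.ne']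

theorem chord_proj {β t : ℝ} (hn : 0 < nFun β t) :
    chord (proj β 0) (proj β t) = chart '' (cone β '' Icc 0 1 ×ˢ {t}) := by
  have hR := arcosh_nFun_pos hn
  have hS : 0 < √(nFun β t * (nFun β t + 2)) := Real.sqrt_pos.2 (by positivity)
  rw [proj_zero, proj_eq_ray hn, chord_ray (chordDir_sq hn) hR]
  -- The ray is a straight segment in the chart; this is the change of parameter from arclength `s`
  -- to the linear parameter `ρ`.
  have key : ∀ s ρ : ℝ, sinh s = ρ * √(nFun β t * (nFun β t + 2)) →
      ray (chordDir β t) s = chart (cone β (ρ, t)) := by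
    intro s ρ h
    rw [← chart_of_mem_L2 (ray_mem_L2 (chordDir_sq hn) s)]
    congr 1
    simp only [ray, chordDir, cone, h]
    ext
    · simp
      field_simp
    · simp
      field_simp
  ext v
  constructor
  · rintro ⟨s, hs, rfl⟩
    refine ⟨_, ⟨(sinh s / √(nFun β t * (nFun β t + 2)), t), ⟨⟨?_, ?_⟩, rfl⟩, rfl⟩, ?_⟩
    · exact div_nonneg (sinh_nonneg_iff.2 hs.1) hS.le
    · simp only
      rw [div_le_one hS, ← sinh_arcosh_nFun hn]
      exact sinh_le_sinh.2 hs.2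
    · refine (key _ _ ?_).symm
      field_simp
  · rintro ⟨_, ⟨⟨ρ, r⟩, ⟨⟨h0, h1⟩, hr⟩, rfl⟩, rfl⟩
    simp only [mem_singleton_iff] at hr h0 h1
    subst hr
    refine ⟨arsinh (ρ * √(nFun β r * (nFun β r + 2))), ⟨?_, ?_⟩, key _ _ (sinh_arsinh _)⟩
    · exact arsinh_nonneg_iff.2 (mul_nonneg h0 hS.le)
    · rw [← sinh_le_sinh, sinh_arsinh, sinh_arcosh_nFun hn]
      exact mul_le_of_le_one_left hS.le h1

/-- The cone map collapses the sides `ρ = 0` and `s = 0` of the rectangle to the origin, sends `ρ =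
1` to the curve and `s = t` to the shortest arc. The image of the closed rectangle is compact and
star-shaped, as scaling only changes `ρ`. -/
theorem digon_eq {β t : ℝ} (hβ : β ≠ 0) (ht : 0 < t) (h : InjOn (proj β) (Icc 0 t)) :
    digon β t = chart '' (cone β '' Ioo 0 1 ×ˢ Ioo 0 t) := by
  have hn := nFun_pos h ⟨ht, le_rfl⟩
  set C : Set (ℝ × ℝ) := cone β '' {1} ×ˢ Icc 0 t ∪ cone β '' Icc 0 1 ×ˢ {t} with hC
  have hb : digonBoundary β t = chart '' C := by
    rw [digonBoundary, chord_proj hn, hC, image_union, singleton_prod]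
    simp only [image_image]
    congr 1
    exact image_congr fun s _ => by simp [cone, proj_eq_chart, planeCurve]
  have hzero : ∀ s : ℝ, cone β (0, s) = 0 := fun s => by simp [cone]
  have hzero' : ∀ ρ : ℝ, cone β (ρ, 0) = 0 := fun ρ => by simp [cone, nFun_zero, mFun_zero]
  have hC0 : (0 : ℝ × ℝ) ∈ C := Or.inr ⟨(0, t), ⟨⟨le_rfl, zero_le_one⟩, rfl⟩, hzero t⟩
  have hK : cone β '' Ioo 0 1 ×ˢ Ioo 0 t ∪ C = cone β '' Icc 0 1 ×ˢ Icc 0 t := by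
    refine Subset.antisymm (union_subset ?_ (union_subset ?_ ?_)) ?_
    · exact image_mono (prod_mono Ioo_subset_Icc_self Ioo_subset_Icc_self)
    · exact image_mono (prod_mono (singleton_subset_iff.2 ⟨zero_le_one, le_rfl⟩) Subset.rfl)
    · exact image_mono (prod_mono Subset.rfl (singleton_subset_iff.2 ⟨ht.le, le_rfl⟩))
    · rintro _ ⟨⟨ρ, s⟩, ⟨hρ, hs⟩, rfl⟩
      simp only at hρ hs
      rcases hρ.1.eq_or_lt with h0 | h0
      · rw [← h0, hzero]
        exact Or.inr hC0
      rcases hs.1.eq_or_lt with h1 | h1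
      · rw [← h1, hzero']
        exact Or.inr hC0
      rcases hρ.2.eq_or_lt with h2 | h2
      · exact Or.inr (Or.inl ⟨(ρ, s), ⟨h2, hs⟩, rfl⟩)
      rcases hs.2.eq_or_lt with h3 | h3
      · exact Or.inr (Or.inr ⟨(ρ, s), ⟨hρ, h3⟩, rfl⟩)
      exact Or.inl ⟨_, ⟨⟨h0, h2⟩, ⟨h1, h3⟩⟩, rfl⟩
  have hd : Disjoint (cone β '' Ioo 0 1 ×ˢ Ioo 0 t) C := by
    have hne : ∀ p ∈ Ioo (0 : ℝ) 1 ×ˢ Ioo 0 t, cone β p ≠ 0 := by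
      rintro p hp h0
      have h1 : p.1 * -(β * nFun β p.2) = 0 := congrArg Prod.snd h0
      have := nFun_pos h ⟨hp.2.1, hp.2.2.le⟩
      exact mul_ne_zero hp.1.1.ne' (neg_ne_zero.2 (mul_ne_zero hβ this.ne')) h1
    rw [disjoint_left]
    rintro _ ⟨p, hp, rfl⟩ (⟨⟨σ, r⟩, ⟨hσ, hr⟩, hqp⟩ | ⟨⟨σ, r⟩, ⟨hσ, hr⟩, hqp⟩)
    · simp only [mem_singleton_iff] at hσ hr
      subst hσ
      rcases hr.1.eq_or_lt with h1 | h1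
      · rw [← h1, hzero'] at hqp
        exact hne p hp hqp.symm
      · have := cone_injOn hβ h one_pos ⟨h1, hr.2⟩ hp.1.1 ⟨hp.2.1, hp.2.2.le⟩ hqp
        exact hp.1.2.ne (by rw [← this])
    · simp only [mem_singleton_iff] at hσ hr
      subst hr
      rcases hσ.1.eq_or_lt with h1 | h1
      · rw [← h1, hzero] at hqp
        exact hne p hp hqp.symm
      · have := cone_injOn hβ h h1 ⟨ht, le_rfl⟩ hp.1.1 ⟨hp.2.1, hp.2.2.le⟩ hqp
        exact hp.2.2.ne (by rw [← this])
  rw [digon, hb]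
  refine interior_eq_chart_image (isOpen_cone_image hβ h) ?_ hd (Or.inr hC0) ?_
  · rw [hK]
    exact (isCompact_Icc.prod isCompact_Icc).image (continuous_cone β)
  · rw [hK]
    rintro _ ⟨p, hp, rfl⟩ r hr
    refine ⟨(r * p.1, p.2), ⟨⟨mul_nonneg hr.1 hp.1.1, mul_le_one₀ hr.2 hp.1.1 hp.1.2⟩, hp.2⟩, ?_⟩
    simp only [cone, Prod.smul_mk, smul_eq_mul, mul_assoc]

/-! ### The area of the digon -/

theorem areaDensity_eq (z : ℝ × ℝ) : areaDensity z = 1 / √(1 + z.1 ^ 2 + z.2 ^ 2) := by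
  have hpos : 0 < 1 + z.1 ^ 2 + z.2 ^ 2 := by positivity
  set w := √(1 + z.1 ^ 2 + z.2 ^ 2) with hw
  have hw0 : 0 < w := Real.sqrt_pos.2 hpos
  have hw2 : w ^ 2 = 1 + z.1 ^ 2 + z.2 ^ 2 := Real.sq_sqrt hpos.le
  have hd : DifferentiableAt ℝ chart z := by
    rw [differentiableAt_pi]
    intro i
    fin_cases i
    · refine DifferentiableAt.sqrt (f := fun z : ℝ × ℝ => 1 + z.1 ^ 2 + z.2 ^ 2) ?_ hpos.ne'
      fun_prop
    · exact differentiableAt_fst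
    · exact differentiableAt_snd
  have e1 : fderiv ℝ chart z (1, 0) = ![z.1 / w, 1, 0] := by
    have hc : HasDerivAt (fun s : ℝ => z + s • ((1 : ℝ), (0 : ℝ))) ((1 : ℝ), (0 : ℝ)) 0 := by
      simpa using ((hasDerivAt_id (0 : ℝ)).smul_const ((1 : ℝ), (0 : ℝ))).const_add z
    have h1 := (show HasFDerivAt chart (fderiv ℝ chart z) (z + (0 : ℝ) • ((1 : ℝ), (0 : ℝ))) by
      simpa using hd.hasFDerivAt).comp_hasDerivAt (0 : ℝ) hc
    refine h1.unique (hasDerivAt_pi.2 fun i => ?_)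
    fin_cases i
    · have h2 : HasDerivAt (fun s : ℝ => 1 + (z.1 + s * 1) ^ 2 + (z.2 + s * 0) ^ 2) (2 * z.1) 0 := by
        refine ((((((hasDerivAt_id (0 : ℝ)).mul_const 1).const_add z.1).pow 2).const_add 1).add
          ((((hasDerivAt_id (0 : ℝ)).mul_const 0).const_add z.2).pow 2)).congr_deriv ?_
        simp
      refine (h2.sqrt (by simpa using hpos.ne')).congr_deriv ?_
      simp [← hw]
      field_simp
    · exact (((hasDerivAt_id (0 : ℝ)).mul_const 1).const_add z.1).congr_deriv (by simp)
    · exact (((hasDerivAt_id (0 : ℝ)).mul_const 0).const_add z.2).congr_deriv (by simp)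
  have e2 : fderiv ℝ chart z (0, 1) = ![z.2 / w, 0, 1] := by
    have hc : HasDerivAt (fun s : ℝ => z + s • ((0 : ℝ), (1 : ℝ))) ((0 : ℝ), (1 : ℝ)) 0 := by
      simpa using ((hasDerivAt_id (0 : ℝ)).smul_const ((0 : ℝ), (1 : ℝ))).const_add z
    have h1 := (show HasFDerivAt chart (fderiv ℝ chart z) (z + (0 : ℝ) • ((0 : ℝ), (1 : ℝ))) by
      simpa using hd.hasFDerivAt).comp_hasDerivAt (0 : ℝ) hc
    refine h1.unique (hasDerivAt_pi.2 fun i => ?_)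
    fin_cases i
    · have h2 : HasDerivAt (fun s : ℝ => 1 + (z.1 + s * 0) ^ 2 + (z.2 + s * 1) ^ 2) (2 * z.2) 0 := by
        refine ((((((hasDerivAt_id (0 : ℝ)).mul_const 0).const_add z.1).pow 2).const_add 1).add
          ((((hasDerivAt_id (0 : ℝ)).mul_const 1).const_add z.2).pow 2)).congr_deriv ?_
        simp
      refine (h2.sqrt (by simpa using hpos.ne')).congr_deriv ?_
      simp [← hw]
      field_simp
    · exact (((hasDerivAt_id (0 : ℝ)).mul_const 0).const_add z.1).congr_deriv (by simp)
    · exact (((hasDerivAt_id (0 : ℝ)).mul_const 1).const_add z.2).congr_deriv (by simp)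
  rw [areaDensity, e1, e2]
  have e3 : mink ![z.1 / w, 1, 0] ![z.1 / w, 1, 0] * mink ![z.2 / w, 0, 1] ![z.2 / w, 0, 1] -
      mink ![z.1 / w, 1, 0] ![z.2 / w, 0, 1] ^ 2 = (1 / w) ^ 2 := by
    simp [mink]
    field_simp
    linear_combination w ^ 2 * hw2
  rw [e3, Real.sqrt_sq (by positivity)]

theorem areaL2_chart_image {A : Set (ℝ × ℝ)} (hA : MeasurableSet A) :
    areaL2 (chart '' A) = ∫⁻ z in A, ENNReal.ofReal (1 / √(1 + z.1 ^ 2 + z.2 ^ 2)) := by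
  have hm : MeasurableSet (chart '' A) := by
    rw [chart_image_eq]
    exact measurableSet_L2.inter (hA.preimage (by fun_prop))
  rw [areaL2, Measure.map_apply continuous_chart.measurable hm,
    preimage_image_eq _ chart_injective, withDensity_apply _ hA]
  simp_rw [areaDensity_eq]

/-- The area density in the coordinates of the cone over the curve. -/
def coneDensity (β : ℝ) (p : ℝ × ℝ) : ℝ :=
  |β| * nFun β p.2 * p.1 / √(1 + p.1 ^ 2 * (nFun β p.2 * (nFun β p.2 + 2)))

theorem continuous_coneDensity (β : ℝ) : Continuous (coneDensity β) := by
  unfold coneDensity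
  refine Continuous.div (by fun_prop) (by fun_prop) fun p => ?_
  have := nFun_nonneg β p.2
  exact (Real.sqrt_pos.2 (by positivity)).ne'

theorem integral_coneDensity (β : ℝ) {s : ℝ} (hn : 0 < nFun β s) :
    ∫ ρ in (0 : ℝ)..1, coneDensity β (ρ, s) = |β| * nFun β s / (nFun β s + 2) := by
  set n := nFun β s with hn_def
  have hA : 0 < n * (n + 2) := by positivity
  have hd : ∀ ρ ∈ uIcc (0 : ℝ) 1, HasDerivAt
      (fun ρ => |β| * n / (n * (n + 2)) * √(1 + ρ ^ 2 * (n * (n + 2)))) (coneDensity β (ρ, s)) ρ := by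
    intro ρ _
    have hpos : 0 < 1 + ρ ^ 2 * (n * (n + 2)) := by positivity
    have h1 : HasDerivAt (fun ρ : ℝ => 1 + ρ ^ 2 * (n * (n + 2))) (2 * ρ * (n * (n + 2))) ρ := by
      refine ((((hasDerivAt_id ρ).pow 2).mul_const (n * (n + 2))).const_add 1).congr_deriv ?_
      simp
    refine ((h1.sqrt hpos.ne').const_mul (|β| * n / (n * (n + 2)))).congr_deriv ?_
    simp only [coneDensity, ← hn_def]
    have := Real.sqrt_pos.2 hpos
    field_simp
  rw [intervalIntegral.integral_eq_sub_of_hasDerivAt hd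
    (((continuous_coneDensity β).comp (by fun_prop)).intervalIntegrable _ _)]
  -- At `ρ = 1` the radicand is the perfect square `(1 + n)²`.
  have h1 : √(1 + 1 ^ 2 * (n * (n + 2))) = 1 + n := by
    rw [show 1 + 1 ^ 2 * (n * (n + 2)) = (1 + n) ^ 2 by ring, Real.sqrt_sq (by positivity)]
  have h0 : √(1 + 0 ^ 2 * (n * (n + 2))) = 1 := by simp
  rw [h1, h0]
  field_simp
  ring

theorem areaL2_digon {β t : ℝ} (hβ : β ≠ 0) (ht : 0 < t) (h : InjOn (proj β) (Icc 0 t)) :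
    areaL2 (digon β t) =
      ENNReal.ofReal (∫ s in (0 : ℝ)..t, |β| * nFun β s / (nFun β s + 2)) := by
  have hmeas : MeasurableSet (Ioo (0 : ℝ) 1 ×ˢ Ioo 0 t) := measurableSet_Ioo.prod measurableSet_Ioo
  have hinj : InjOn (cone β) (Ioo (0 : ℝ) 1 ×ˢ Ioo 0 t) := fun p hp q hq hpq =>
    cone_injOn hβ h hp.1.1 ⟨hp.2.1, hp.2.2.le⟩ hq.1.1 ⟨hq.2.1, hq.2.2.le⟩ hpq
  have hint : IntegrableOn (coneDensity β) (Ioo (0 : ℝ) 1 ×ˢ Ioo 0 t) volume :=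
    ((continuous_coneDensity β).continuousOn.integrableOn_compact
      (isCompact_Icc.prod isCompact_Icc)).mono_set
      (prod_mono Ioo_subset_Icc_self Ioo_subset_Icc_self)
  have hint' : IntegrableOn (fun p : ℝ × ℝ => coneDensity β p.swap) (Ioo 0 t ×ˢ Ioo (0 : ℝ) 1)
      (volume.prod volume) :=
    (((continuous_coneDensity β).comp continuous_swap).continuousOn.integrableOn_compact
      (isCompact_Icc.prod isCompact_Icc)).mono_set
      (prod_mono Ioo_subset_Icc_self Ioo_subset_Icc_self)
  have hnn : ∀ p ∈ Ioo (0 : ℝ) 1 ×ˢ Ioo 0 t, 0 ≤ coneDensity β p := by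
    intro p hp
    have := nFun_nonneg β p.2
    have := hp.1.1.le
    unfold coneDensity
    positivity
  rw [digon_eq hβ ht h, areaL2_chart_image (isOpen_cone_image hβ h).measurableSet,
    lintegral_image_eq_lintegral_abs_det_fderiv_mul volume hmeas
      (fun p _ => (hasFDerivAt_cone β p).hasFDerivWithinAt) hinj]
  have e1 : ∫⁻ p in Ioo (0 : ℝ) 1 ×ˢ Ioo 0 t, ENNReal.ofReal |(coneDeriv β p).det| *
      ENNReal.ofReal (1 / √(1 + (cone β p).1 ^ 2 + (cone β p).2 ^ 2)) =
      ∫⁻ p in Ioo (0 : ℝ) 1 ×ˢ Ioo 0 t, ENNReal.ofReal (coneDensity β p) := by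
    refine setLIntegral_congr_fun hmeas fun p hp => ?_
    have := nFun_nonneg β p.2
    rw [← ENNReal.ofReal_mul (abs_nonneg _), det_coneDeriv, abs_neg, abs_mul,
      abs_of_nonneg (mul_nonneg hp.1.1.le this), mul_one_div, coneDensity]
    congr 2
    · ring
    · congr 1
      simp only [cone]
      -- The first integral in the form `m² + β²n² = n(n + 2)`.
      linear_combination p.1 ^ 2 * mFun_sq β p.2
  rw [e1, ← ofReal_integral_eq_lintegral_ofReal hint
    ((ae_restrict_iff' hmeas).2 (Filter.Eventually.of_forall hnn))]
  congr 1
  -- The factors are swapped so that the inner integral of Fubini is over `ρ`.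
  have e2 : ∫ p in Ioo (0 : ℝ) 1 ×ˢ Ioo 0 t, coneDensity β p =
      ∫ p in Ioo 0 t ×ˢ Ioo (0 : ℝ) 1, coneDensity β p.swap ∂(volume.prod volume) :=
    (setIntegral_prod_swap (μ := volume) (ν := volume) (Ioo (0 : ℝ) 1) (Ioo 0 t)
      (coneDensity β)).symm
  rw [e2, setIntegral_prod _ hint', intervalIntegral.integral_of_le ht.le, integral_Ioc_eq_integral_Ioo]
  refine setIntegral_congr_fun measurableSet_Ioo fun s hs => ?_
  simp only [Prod.swap_prod_mk]
  rw [← integral_coneDensity β (nFun_pos h ⟨hs.1, hs.2.le⟩),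
    intervalIntegral.integral_of_le zero_le_one, integral_Ioc_eq_integral_Ioo]

theorem areaL2_digon_ne_top {β t : ℝ} (hβ : β ≠ 0) (ht : 0 < t) (h : InjOn (proj β) (Icc 0 t)) :
    areaL2 (digon β t) ≠ ⊤ := by
  rw [areaL2_digon hβ ht h]
  exact ENNReal.ofReal_ne_top

theorem digonArea_eq_integral {β t : ℝ} (hβ : β ≠ 0) (ht : 0 < t) (h : InjOn (proj β) (Icc 0 t)) :
    digonArea β t = ∫ s in (0 : ℝ)..t, |β| * nFun β s / (nFun β s + 2) := by
  rw [digonArea, areaL2_digon hβ ht h, ENNReal.toReal_ofReal]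
  refine intervalIntegral.integral_nonneg ht.le fun s _ => ?_
  have := nFun_nonneg β s
  positivity

theorem continuous_digonArea_integrand (β : ℝ) :
    Continuous fun s => |β| * nFun β s / (nFun β s + 2) :=
  Continuous.div (by fun_prop) (by fun_prop) fun s => by linarith [nFun_nonneg β s]

theorem hasDerivAt_digonArea {β t : ℝ} (hβ : β ≠ 0) (ht : 0 < t)
    (h : InjOn (proj β) (Icc 0 t)) :
    HasDerivAt (digonArea β) (|β| * nFun β t / (nFun β t + 2)) t := by
  -- A two-sided derivative needs the integral formula also slightly beyond `t`.
  obtain ⟨t₂, h2, h3⟩ := exists_gt_injOn_proj h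
  have hc := continuous_digonArea_integrand β
  refine (intervalIntegral.integral_hasDerivAt_right (hc.intervalIntegrable 0 t)
    (hc.stronglyMeasurableAtFilter _ _) hc.continuousAt).congr_of_eventuallyEq ?_
  filter_upwards [Ioo_mem_nhds ht h2] with s hs
  exact digonArea_eq_integral hβ hs.1 (h3.mono (Icc_subset_Icc_right hs.2.le))

/-! ### The angles of the digon -/

/-- The angle at `x(0)` between the curve and the shortest arc `[x(0) x(t)]`. -/
def digonAngle (β t : ℝ) : ℝ := arccos (mFun β t / √(nFun β t * (nFun β t + 2)))

theorem abs_mFun_div_le_one (β t : ℝ) : |mFun β t / √(nFun β t * (nFun β t + 2))| ≤ 1 := by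
  have hn := nFun_nonneg β t
  rw [abs_div, abs_of_nonneg (Real.sqrt_nonneg _)]
  refine div_le_one_of_le₀ (Real.abs_le_sqrt ?_) (Real.sqrt_nonneg _)
  rw [mFun_sq]
  nlinarith [mul_nonneg (sq_nonneg β) (sq_nonneg (nFun β t))]

theorem cos_digonAngle (β t : ℝ) :
    cos (digonAngle β t) = mFun β t / √(nFun β t * (nFun β t + 2)) :=
  have h := abs_le.1 (abs_mFun_div_le_one β t)
  cos_arccos h.1 h.2

theorem isDigonAngle_digonAngle {β t : ℝ} (hn : 0 < nFun β t) :
    IsDigonAngle β t (digonAngle β t) := by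
  have hu := chordDir_sq hn
  have hR := arcosh_nFun_pos hn
  have hA : 0 < nFun β t * (nFun β t + 2) := by positivity
  have hS := Real.sqrt_pos.2 hA
  rw [IsDigonAngle, proj_zero, proj_eq_ray hn]
  refine ⟨⟨_, _, isShortestArc_ray hu hR⟩, fun c l h => ?_⟩
  obtain ⟨rfl, hc⟩ := h.eq_ray hu hR
  have h0 : (0 : ℝ) ∈ Icc 0 (arcosh (1 + nFun β t)) := ⟨le_rfl, hR.le⟩
  have h1 : arcosh (1 + nFun β t) ∈ Icc 0 (arcosh (1 + nFun β t)) := ⟨hR.le, le_rfl⟩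
  -- The curve has unit speed, as does the ray, so the cosine of the angle is just the product of
  -- the velocities.
  have s1 : ∀ s, mink (![mFun β s, 1 + (1 - β ^ 2) * nFun β s, -(β * mFun β s)] : Mink)
      ![mFun β s, 1 + (1 - β ^ 2) * nFun β s, -(β * mFun β s)] = 1 := by
    intro s
    simp [mink]
    linear_combination (β ^ 2 - 1) * mFun_sq β s
  have hneg : ∀ v w : Mink, minkAngle (-v) (-w) = minkAngle v w := by
    intro v w
    simp [minkAngle, mink]
  constructor
  · have s2 := mink_derivWithin_ray hu hR h0
    rw [derivWithin_congr hc (hc h0), minkAngle, s2, (hasDerivAt_proj β 0).deriv, s1,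
      derivWithin_ray _ hR h0, digonAngle]
    simp [mink, mFun_zero, nFun_zero, chordDir]
  · have s2 := mink_derivWithin_ray hu hR h1
    rw [hneg, derivWithin_congr hc (hc h1), minkAngle, s2, (hasDerivAt_proj β t).deriv, s1,
      derivWithin_ray _ hR h1, digonAngle, sinh_arcosh_nFun hn, cosh_arcosh (by linarith)]
    congr 1
    simp only [mink, chordDir]
    simp
    rw [← sub_eq_zero]
    have hq := Real.sq_sqrt hA.le
    set r := √(nFun β t * (nFun β t + 2))
    field_simp
    -- With `r = sinh R` and `1 + n = cosh R` the product at `x(t)` is `(m / r)((1 + n)² - r²) = m /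
    -- r`, the same as at `x(0)`.
    linear_combination -mFun β t * hq

theorem hasDerivAt_digonAngle {β t : ℝ} (hβ : β ≠ 0) (hn : 0 < nFun β t) :
    HasDerivAt (digonAngle β) (|β| / (nFun β t + 2)) t := by
  have hA : 0 < nFun β t * (nFun β t + 2) := by positivity
  have hb := abs_pos.2 hβ
  have hr := Real.sqrt_pos.2 hA
  have hr2 := Real.sq_sqrt hA.le
  have hm := hasDerivAt_mFun β t
  have hn' := hasDerivAt_nFun β t
  have hm2 := mFun_sq β t
  -- This is `sin² ψ`; its positivity keeps the argument of `arccos` away from `±1`.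
  have hsq : 1 - (mFun β t / √(nFun β t * (nFun β t + 2))) ^ 2 =
      (|β| * nFun β t / √(nFun β t * (nFun β t + 2))) ^ 2 := by
    rw [div_pow, div_pow, hr2, mul_pow, sq_abs]
    field_simp
    linear_combination -hm2
  have hpos : 0 < |β| * nFun β t / √(nFun β t * (nFun β t + 2)) := by positivity
  have hne : 0 < 1 - (mFun β t / √(nFun β t * (nFun β t + 2))) ^ 2 := by
    rw [hsq]
    positivity
  have hA' : HasDerivAt (fun s => nFun β s * (nFun β s + 2)) (2 * mFun β t * (nFun β t + 1)) t := by
    refine (hn'.mul (hn'.add_const 2)).congr_deriv ?_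
    ring
  have hg := hm.fun_div (hA'.sqrt hA.ne') hr.ne'
  refine ((hasDerivAt_arccos ?_ ?_).comp t hg).congr_deriv ?_
  · intro h
    rw [h] at hne
    norm_num at hne
  · intro h
    rw [h] at hne
    norm_num at hne
  · rw [hsq, Real.sqrt_sq hpos.le]
    set n := nFun β t
    set m := mFun β t
    set r := √(n * (n + 2))
    have hβ2 := sq_abs β
    have h2 : r ^ 2 * (1 + (1 - β ^ 2) * n) - m ^ 2 * (n + 1) = -(|β| ^ 2 * n ^ 2) := by
      rw [hr2, hβ2]
      linear_combination -(n + 1) * hm2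
    have h3 : ((1 + (1 - β ^ 2) * n) * r - m * (2 * m * (n + 1) / (2 * r))) / r ^ 2 =
        -(|β| ^ 2 * n ^ 2) / (r * (n * (n + 2))) := by
      rw [← h2, ← hr2]
      field_simp
    rw [h3]
    field_simp

/-- At `0` itself the quotient is `0 / 0 = 0` and `digonAngle` takes the value `π / 2`, so only the
one-sided limit is meaningful. For small `s > 0` one has `m > 0`, and after cancelling `n` the
cosine is `√((2 + (1 - β²)n) / (n + 2))`, which extends continuously by `1`. -/
theorem tendsto_digonAngle (β : ℝ) :
    Filter.Tendsto (digonAngle β) (nhdsWithin 0 (Ioi 0)) (nhds 0) := by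
  have hc : Continuous fun s => arccos √((2 + (1 - β ^ 2) * nFun β s) / (nFun β s + 2)) :=
    continuous_arccos.comp <| Continuous.sqrt <| Continuous.div (by fun_prop) (by fun_prop)
      fun s => by linarith [nFun_nonneg β s]
  have h0 : arccos √((2 + (1 - β ^ 2) * nFun β 0) / (nFun β 0 + 2)) = 0 := by
    simp [nFun_zero]
  have hT : ∃ T > 0, ∀ s, 0 < s → s < T → 0 < mFun β s := by
    rcases le_or_gt (β ^ 2) 1 with h | h
    · exact ⟨1, one_pos, fun s hs _ => mFun_pos hs (Or.inl h)⟩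
    · have := Real.sqrt_pos.2 (sub_pos.2 h)
      exact ⟨π / √(β ^ 2 - 1), by positivity, fun s hs hs' => mFun_pos hs (Or.inr hs')⟩
  obtain ⟨T, hT0, hT⟩ := hT
  have hlim := (hc.tendsto 0).mono_left (nhdsWithin_le_nhds (s := Ioi 0))
  rw [h0] at hlim
  refine hlim.congr' ?_
  filter_upwards [Ioo_mem_nhdsGT hT0] with s hs
  have hm := hT s hs.1 hs.2
  have hm2 := mFun_sq β s
  have hn : 0 < nFun β s := by
    refine (nFun_nonneg β s).lt_of_ne' fun h => ?_
    rw [h] at hm2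
    nlinarith
  rw [digonAngle]
  congr 1
  rw [← Real.sqrt_sq hm.le, ← Real.sqrt_div (sq_nonneg _), hm2]
  congr 1
  field_simp

theorem digonArea_eq {β t : ℝ} (hβ : β ≠ 0) (ht : 0 < t) (h : InjOn (proj β) (Icc 0 t)) :
    digonArea β t = |β| * t - 2 * digonAngle β t := by
  rw [digonArea_eq_integral hβ ht h]
  -- `F' = 0` on `(0, t]` because `n / (n + 2) + 2 / (n + 2) = 1`; the constant is found from the
  -- limit at `0+`.
  set F : ℝ → ℝ := fun s => (∫ r in (0 : ℝ)..s, |β| * nFun β r / (nFun β r + 2)) -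
    |β| * s + 2 * digonAngle β s with hF
  have hc := continuous_digonArea_integrand β
  have hI : ∀ s, HasDerivAt (fun s => ∫ r in (0 : ℝ)..s, |β| * nFun β r / (nFun β r + 2))
      (|β| * nFun β s / (nFun β s + 2)) s := fun s =>
    intervalIntegral.integral_hasDerivAt_right (hc.intervalIntegrable 0 s)
      (hc.stronglyMeasurableAtFilter _ _) hc.continuousAt
  have hd : ∀ s ∈ Ioc 0 t, HasDerivAt F 0 s := by
    intro s hs
    have hn := nFun_pos h hs
    refine (((hI s).sub ((hasDerivAt_id s).const_mul |β|)).add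
      ((hasDerivAt_digonAngle hβ hn).const_mul 2)).congr_deriv ?_
    field_simp
    ring
  have hconst : ∀ s ∈ Ioc 0 t, F s = F t := fun s hs =>
    (constant_of_has_deriv_right_zero
      (fun r hr => (hd r ⟨hs.1.trans_le hr.1, hr.2⟩).continuousAt.continuousWithinAt)
      (fun r hr => (hd r ⟨hs.1.trans_le hr.1, hr.2.le⟩).hasDerivWithinAt) t ⟨hs.2, le_rfl⟩).symm
  have hlim : Filter.Tendsto F (nhdsWithin 0 (Ioi 0)) (nhds 0) := by
    have h1 : Filter.Tendsto
        (fun s => (∫ r in (0 : ℝ)..s, |β| * nFun β r / (nFun β r + 2)) - |β| * s)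
        (nhdsWithin 0 (Ioi 0)) (nhds 0) := by
      have := ((hI 0).continuousAt.fun_sub (continuousAt_id.const_mul |β|)).tendsto.mono_left
        (nhdsWithin_le_nhds (s := Ioi 0))
      simpa using this
    simpa using h1.add ((tendsto_digonAngle β).const_mul 2)
  have hFt : F t = 0 := by
    refine tendsto_nhds_unique (tendsto_const_nhds.congr' ?_) hlim
    filter_upwards [Ioc_mem_nhdsGT ht] with s hs
    exact (hconst s hs).symm
  simp only [hF] at hFt
  linarith

/-! ### The length of the shortest arc -/

theorem chordLength_eq {β t : ℝ} (hn : 0 < nFun β t) :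
    chordLength β t = arcosh (1 + nFun β t) := by
  rw [chordLength, proj_zero, proj_eq_ray hn, hypDist_ray (chordDir_sq hn) (arcosh_nFun_pos hn)]

theorem hasDerivAt_chordLength {β t : ℝ} (hn : 0 < nFun β t) :
    HasDerivAt (chordLength β) (cos (digonAngle β t)) t := by
  have h1 : HasDerivAt (fun s => arcosh (1 + nFun β s)) (cos (digonAngle β t)) t := by
    refine ((hasDerivAt_arcosh (x := 1 + nFun β t) (by simpa using hn)).comp t
      ((hasDerivAt_nFun β t).const_add 1)).congr_deriv ?_
    rw [cos_digonAngle, inv_mul_eq_div]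
    congr 2
    ring
  refine h1.congr_of_eventuallyEq ?_
  filter_upwards [(continuous_nFun β).continuousAt.eventually (lt_mem_nhds hn)] with s hs
  exact chordLength_eq hs

theorem digonAngle_mem_Ioo {β t : ℝ} (hβ : β ≠ 0) (hn : 0 < nFun β t) (hm : 0 < mFun β t) :
    0 < digonAngle β t ∧ digonAngle β t < π / 2 := by
  have hA : 0 < nFun β t * (nFun β t + 2) := by positivity
  have hS := Real.sqrt_pos.2 hA
  refine ⟨arccos_pos.2 ?_, arccos_lt_pi_div_two.2 (div_pos hm hS)⟩
  rw [div_lt_one hS]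
  refine Real.lt_sqrt_of_sq_lt ?_
  rw [mFun_sq]
  -- This is the gap `n(n + 2) - m²`, so `cos ψ < 1` strictly.
  have : 0 < β ^ 2 * nFun β t ^ 2 := by positivity
  nlinarith

end Lobachevskii

end

theorem proposition4p2 (β : ℝ) (hβ : β ≠ 0) :
    (∀ t₁ : ℝ, 0 ≤ t₁ → (β ^ 2 ≤ 1 ∨ t₁ < 2 * π / √(β ^ 2 - 1)) →
      InjOn (Lobachevskii.proj β) (Icc 0 t₁)) ∧
    ∀ t₁ : ℝ, 0 < t₁ → InjOn (Lobachevskii.proj β) (Icc 0 t₁) →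
      (∃ c, Lobachevskii.IsShortestArc (Lobachevskii.proj β 0) (Lobachevskii.proj β t₁) c
        (Lobachevskii.chordLength β t₁)) ∧
      Lobachevskii.areaL2 (Lobachevskii.digon β t₁) ≠ ⊤ ∧
      ∃ ψ : ℝ, Lobachevskii.IsDigonAngle β t₁ ψ ∧
        Lobachevskii.digonArea β t₁ = |β| * t₁ - 2 * ψ ∧
        Lobachevskii.chordLength β t₁ = Real.arcosh (1 + Lobachevskii.nFun β t₁) ∧
        HasDerivAt (Lobachevskii.chordLength β) (Real.cos ψ) t₁ ∧
        Real.cos ψ = Lobachevskii.mFun β t₁ /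
          √(Lobachevskii.nFun β t₁ * (Lobachevskii.nFun β t₁ + 2)) ∧
        HasDerivAt (Lobachevskii.digonArea β)
          (|β| * Lobachevskii.nFun β t₁ / (Lobachevskii.nFun β t₁ + 2)) t₁ ∧
        0 < |β| * Lobachevskii.nFun β t₁ / (Lobachevskii.nFun β t₁ + 2) ∧
        ((β ^ 2 ≤ 1 ∨ t₁ < π / √(β ^ 2 - 1)) → 0 < ψ ∧ ψ < π / 2) := by
  refine ⟨fun t₁ _ h => Lobachevskii.injOn_proj h, fun t ht h => ?_⟩
  have hn := Lobachevskii.nFun_pos h ⟨ht, le_rfl⟩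
  have hb := abs_pos.2 hβ
  refine ⟨⟨Lobachevskii.ray (Lobachevskii.chordDir β t), ?_⟩,
    Lobachevskii.areaL2_digon_ne_top hβ ht h, Lobachevskii.digonAngle β t,
    Lobachevskii.isDigonAngle_digonAngle hn, Lobachevskii.digonArea_eq hβ ht h,
    Lobachevskii.chordLength_eq hn, Lobachevskii.hasDerivAt_chordLength hn,
    Lobachevskii.cos_digonAngle β t, Lobachevskii.hasDerivAt_digonArea hβ ht h, by positivity,
    fun h' => Lobachevskii.digonAngle_mem_Ioo hβ hn (Lobachevskii.mFun_pos ht h')⟩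
  rw [Lobachevskii.chordLength_eq hn, Lobachevskii.proj_zero, Lobachevskii.proj_eq_ray hn]
  exact Lobachevskii.isShortestArc_ray (Lobachevskii.chordDir_sq hn)
    (Lobachevskii.arcosh_nFun_pos hn)
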